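/- Let $K$ be an integral domain containing $\mathbb Q$ as a subring, and let $f\in zK[[z]]$ be unitary, i.e. $f=z+(\text{terms of degree}\ge 2)$. Let $f^{[0]}=z$, $f^{[n+1]}=f^{[n]}\circ f$ be the compositional iterates of $f$, and let $\mathcal F=\{f^{[0]},f^{[1]},f^{[2]},\dots\}\subseteq K[[z]]$. Let $[f]=([f]_{ij})_{i,j\ge 0}$ be the infinite upper triangular matrix over $K$ given by $f^i=\sum_{j\ge 0}[f]_{ij}z^j$, and let $\log\,[f]=\sum_{n\ge 1}\frac{(-1)^{n+1}}{n}([f]-1)^n$ (each entry of this sum has only finitely many non-zero terms). For $h=\sum_n h_nz^n\in z^2K[[z]]$ let $\langle h\rangle$ be the upper triangular matrix with entries $\langle h\rangle_{ij}=i\,h_{j-i+1}$ for $i\le j$ (and $0$ for $i>j$). There is a unique $h\in z^2K[[z]]$ with $\log\,[f]=\langle h\rangle$; it is called the iterative logarithm of $f$ and denoted by $f_*$. Equip $K[[z]]$ with the derivation $\frac{d}{dz}$, and let $K[z]\{Y\}=K[z][Y,Y',Y'',\dots]$ be the ring of differential polynomials over $K[z]$; for $P\in K[z]\{Y\}$ and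 $y\in K[[z]]$ write $P(y)$ for the result of substituting $y,y',y'',\dots$ for $Y,Y',Y'',\dots$ in $P$. An element $y\in K[[z]]$ is differentially algebraic if $P(y)=0$ for some non-zero $P\in K[z]\{Y\}$, and differentially transcendental otherwise. A set $\mathcal G\subseteq K[[z]]$ is coherent if there is a single non-zero $P\in K[z]\{Y\}$ with $P(y)=0$ for all $y\in\mathcal G$, and incoherent otherwise; it is totally incoherent if every infinite subset of $\mathcal G$ is incoherent. Then exactly one of the following holds: 1. $f_*$ is differentially algebraic and $\mathcal F$ is coherent; 2. $f_*$ is differentially transcendental and $\mathcal F$ is totally incoherent. -/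

import Mathlib

open scoped PowerSeries Polynomial

noncomputable section

namespace ItLog

variable {K : Type*} [CommRing K]

/-- A power series `f ∈ zK[[z]]` is unitary if its coefficient of `z` is `1`. -/
def IsUnitary (f : K⟦X⟧) : Prop :=
  PowerSeries.coeff 0 f = 0 ∧ PowerSeries.coeff 1 f = 1

/-- The `n`-th compositional iterate: `f^[0] = z` and `f^[n+1] = f^[n] ∘ f`.
(`PowerSeries.subst f g` is `g ∘ f`.) -/
def iterate (f : K⟦X⟧) : ℕ → K⟦X⟧
  | 0 => PowerSeries.X
  | n + 1 => PowerSeries.subst f (iterate f n)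

/-- The family of iterates `f^[0], f^[1], f^[2], …`, as a set. -/
def iterates (f : K⟦X⟧) : Set K⟦X⟧ := Set.range (iterate f)

/-- Product of upper triangular `ℕ × ℕ` matrices. For an upper triangular `N` the sum
`∑ₖ M i k * N k j` only has nonzero terms for `k ≤ j`. -/
def triMul (M N : Matrix ℕ ℕ K) : Matrix ℕ ℕ K :=
  fun i j => ∑ k ∈ Finset.range (j + 1), M i k * N k j

/-- Powers of an upper triangular `ℕ × ℕ` matrix. -/
def triPow (M : Matrix ℕ ℕ K) : ℕ → Matrix ℕ ℕ K
  | 0 => 1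
  | n + 1 => triMul (triPow M n) M

/-- The logarithm `log M = ∑_{n ≥ 1} (-1)^(n+1) (M - 1)^n / n` of an upper triangular matrix `M`
with ones on the diagonal. Since `M - 1` is strictly upper triangular, the `(i, j)` entry of
`(M - 1)^n` vanishes for `n > j`, so that the sum for the `(i, j)` entry stops at `n = j`. -/
def triLog [Algebra ℚ K] (M : Matrix ℕ ℕ K) : Matrix ℕ ℕ K :=
  fun i j => ∑ n ∈ Finset.Icc 1 j, ((-1 : ℚ) ^ (n + 1) / (n : ℚ)) • triPow (M - 1) n i j

/-- The iteration matrix `[f]` of `f ∈ zK[[z]]` (for the reference sequence `1, 1, 1, …`): its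
`i`-th row lists the coefficients of `f ^ i`. -/
def iterationMatrix (f : K⟦X⟧) : Matrix ℕ ℕ K :=
  fun i j => PowerSeries.coeff j (f ^ i)

/-- The infinitesimal iteration matrix `⟨h⟩` of `h ∈ zK[[z]]` (for the reference sequence
`1, 1, 1, …`): the upper triangular matrix with entries `i * h_{j-i+1}` for `i ≤ j`. -/
def infinitesimalMatrix (h : K⟦X⟧) : Matrix ℕ ℕ K :=
  fun i j => if i ≤ j then (i : K) * PowerSeries.coeff (j - i + 1) h else 0

/-- `h` is an iterative logarithm of `f`: `h ∈ z²K[[z]]` and `log [f] = ⟨h⟩`. -/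
def IsIterativeLogarithm [Algebra ℚ K] (f h : K⟦X⟧) : Prop :=
  (PowerSeries.X ^ 2 ∣ h) ∧ triLog (iterationMatrix f) = infinitesimalMatrix h

variable (K) in
/-- Differential polynomials `K[z]{Y} = K[z][Y, Y', Y'', …]`; the variable `n` is `Y^(n)`. -/
abbrev DiffPoly : Type _ := MvPolynomial ℕ K[X]

/-- The value `P(y)`: substitute `y, y', y'', …` (derivatives with respect to `z`) for
`Y, Y', Y'', …`. -/
def DiffPoly.evalAt (P : DiffPoly K) (y : K⟦X⟧) : K⟦X⟧ :=
  MvPolynomial.eval₂ (Polynomial.coeToPowerSeries.ringHom (R := K))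
    (fun n => (PowerSeries.derivative K)^[n] y) P

/-- `y` is differentially algebraic (over `K[z]`). -/
def IsDiffAlgebraic (y : K⟦X⟧) : Prop :=
  ∃ P : DiffPoly K, P ≠ 0 ∧ P.evalAt y = 0

/-- `y` is differentially transcendental (over `K[z]`). -/
def IsDiffTranscendental (y : K⟦X⟧) : Prop := ¬ IsDiffAlgebraic y

/-- All members of the family satisfy a common algebraic differential equation. -/
def IsCoherent (F : Set K⟦X⟧) : Prop :=
  ∃ P : DiffPoly K, P ≠ 0 ∧ ∀ y ∈ F, P.evalAt y = 0

def IsIncoherent (F : Set K⟦X⟧) : Prop := ¬ IsCoherent F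

/-- Every infinite subset of the family is incoherent. -/
def IsTotallyIncoherent (F : Set K⟦X⟧) : Prop :=
  ∀ G : Set K⟦X⟧, G ⊆ F → G.Infinite → IsIncoherent G

end ItLog

end

open scoped PowerSeries Polynomial

noncomputable section

namespace ItLog

/-! ### Unipotent endomorphisms and binomial polynomials -/

section

variable {K : Type*} [CommRing K]

/-! Composition with `f` is a unipotent endomorphism `σ = 1 + δ` of `K⟦X⟧`, so `σ^T = ∑ (T choose k)
δ^k` defines a family `f^[T]` whose coefficients are polynomials in `T`. Identities for it need only
be checked at natural `T`. The coefficient of `T` is `log σ`, a derivation, hence `f_* · d/dz`; its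
matrix is `log [f]`. Comparing two forms of `∂f^[T]/∂T` gives Julia's equation `f_*(f^[T]) = f_* ·
∂f^[T]/∂z` (`flow_generator_X`).

If `f_*` is differentially algebraic, it generates with `z` a differential ring of finite
transcendence degree over `K`. By Julia's equation and the chain rule, all z-derivatives of `f^[T]`
are algebraic over two copies of that ring, so `f^[T]` satisfies a differential equation free of
`T`, which every iterate inherits (`isCoherent_iterates`).

Conversely, if `P` kills infinitely many iterates, then `P(f^[T]) = 0` identically in `T`. Its
`T`-coefficients are `Q_k(f_*)`, with `Q_k` independent of `f`. If `f_*` is differentially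
transcendental, every `Q_k` is zero, so `P` kills every unitary series, which forces `P = 0`
(`isDiffAlgebraic_iterLog`). -/

/-- `σ` is the identity up to terms of higher order. -/
def IsUnipotent (σ : K⟦X⟧ →ₐ[K] K⟦X⟧) : Prop :=
  ∀ k g, PowerSeries.X ^ k ∣ g → PowerSeries.X ^ (k + 1) ∣ σ g - g

/-- The operator `σ - 1`. -/
def delta (σ : K⟦X⟧ →ₐ[K] K⟦X⟧) : Module.End K K⟦X⟧ := σ.toLinearMap - 1

theorem delta_apply (σ : K⟦X⟧ →ₐ[K] K⟦X⟧) (g : K⟦X⟧) : delta σ g = σ g - g := rfl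

theorem IsUnipotent.X_pow_dvd_delta_pow {σ : K⟦X⟧ →ₐ[K] K⟦X⟧} (hσ : IsUnipotent σ)
    (g : K⟦X⟧) (k : ℕ) : PowerSeries.X ^ k ∣ (delta σ ^ k) g := by
  induction k with
  | zero => simp
  | succ k ih =>
    rw [pow_succ' (delta σ), Module.End.mul_apply]
    exact hσ _ _ ih

theorem IsUnipotent.coeff_delta_pow {σ : K⟦X⟧ →ₐ[K] K⟦X⟧} (hσ : IsUnipotent σ)
    (g : K⟦X⟧) {j k : ℕ} (h : j < k) : PowerSeries.coeff j ((delta σ ^ k) g) = 0 :=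
  PowerSeries.X_pow_dvd_iff.1 (hσ.X_pow_dvd_delta_pow g k) j h

theorem IsUnipotent.X_pow_dvd_map {σ : K⟦X⟧ →ₐ[K] K⟦X⟧} (hσ : IsUnipotent σ)
    {k : ℕ} {g : K⟦X⟧} (h : PowerSeries.X ^ k ∣ g) : PowerSeries.X ^ k ∣ σ g := by
  have h1 := (pow_dvd_pow (PowerSeries.X : K⟦X⟧) (Nat.le_succ k)).trans (hσ k g h)
  simpa using dvd_add h1 h

/-- Binomial theorem for `1 + δ`. The right side still makes sense when `n` becomes an
indeterminate. -/
theorem iterate_eq_sum_delta_pow (σ : K⟦X⟧ →ₐ[K] K⟦X⟧) (n : ℕ) (g : K⟦X⟧) :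
    (σ ^ n) g = ∑ k ∈ Finset.range (n + 1), (n.choose k : K) • (delta σ ^ k) g := by
  have h1 : ∀ n : ℕ, (σ ^ n) g = ((delta σ + 1) ^ n) g := by
    intro n
    induction n with
    | zero => simp
    | succ n ih =>
      rw [pow_succ', pow_succ', Module.End.mul_apply, ← ih]
      simp [delta_apply]
  rw [h1, (Commute.one_right (delta σ)).add_pow, LinearMap.sum_apply]
  refine Finset.sum_congr rfl fun k _ => ?_
  rw [one_pow, mul_one, Module.End.mul_apply]
  rw [show ((n.choose k : ℕ) : Module.End K K⟦X⟧) g = (n.choose k : K) • g by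
    simp [Nat.cast_smul_eq_nsmul], map_smul]

/-- Coefficientwise specialization `T ↦ a`. -/
def spec (a : K) : K[X]⟦X⟧ →+* K⟦X⟧ := PowerSeries.map (Polynomial.evalRingHom a)

theorem coeff_spec (a : K) (u : K[X]⟦X⟧) (j : ℕ) :
    PowerSeries.coeff j (spec a u) = (PowerSeries.coeff j u).eval a := by
  simp [spec]

section Flow

variable [Algebra ℚ K]

/-- The binomial coefficient `T.choose k` as a polynomial in `T`. -/
def binomPoly (K : Type*) [CommRing K] [Algebra ℚ K] (k : ℕ) : K[X] :=
  Polynomial.C (algebraMap ℚ K (k.factorial : ℚ)⁻¹) * descPochhammer K k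

theorem eval_binomPoly (n k : ℕ) : (binomPoly K k).eval (n : K) = n.choose k := by
  rw [binomPoly, Polynomial.eval_mul, Polynomial.eval_C, descPochhammer_eval_eq_descFactorial,
    Nat.descFactorial_eq_factorial_mul_choose, Nat.cast_mul, ← mul_assoc,
    ← map_natCast (algebraMap ℚ K), ← map_mul, inv_mul_cancel₀ (by positivity), map_one, one_mul]

/-- `T` factors out of the falling factorial, and the remaining factor at `0` is `(-1)^k k!`. These
are the coefficients of the logarithm series. -/
theorem coeff_one_binomPoly_succ (k : ℕ) :
    (binomPoly K (k + 1)).coeff 1 = algebraMap ℚ K ((-1) ^ k / (k + 1 : ℕ)) := by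
  have h1 : ((descPochhammer K k).comp (Polynomial.X - 1)).coeff 0
      = algebraMap ℚ K ((-1) ^ k * k.factorial) := by
    rw [Polynomial.coeff_zero_eq_eval_zero, Polynomial.eval_comp]
    have := ascPochhammer_eval_neg_eq_descPochhammer (R := K) (-1) k
    simp only [neg_neg, ascPochhammer_eval_one] at this
    simp only [Polynomial.eval_sub, Polynomial.eval_X, Polynomial.eval_one, zero_sub, map_mul,
      map_pow, map_neg, map_one, map_natCast]
    rw [this, ← mul_assoc, ← mul_pow]
    simp
  rw [binomPoly, Polynomial.coeff_C_mul, descPochhammer_succ_left,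
    show (1 : ℕ) = 0 + 1 from rfl, Polynomial.coeff_X_mul, h1, ← map_mul, Nat.factorial_succ]
  congr 1
  have : (k.factorial : ℚ) ≠ 0 := by positivity
  push_cast
  field_simp

theorem coeff_one_binomPoly_zero : (binomPoly K 0).coeff 1 = 0 := by
  simp [binomPoly, Polynomial.coeff_one]

end Flow

end

/-! ### Families with parameter `T`; the flow and its generator -/

section

variable {K : Type*} [CommRing K]

theorem spec_ext [IsDomain K] {S : Set K} (hS : S.Infinite) {u v : K[X]⟦X⟧}
    (h : ∀ a ∈ S, spec a u = spec a v) : u = v := by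
  ext1 j
  refine Polynomial.eq_of_infinite_eval_eq _ _ (hS.mono fun a ha => ?_)
  simp only [Set.mem_ofPred_eq, ← coeff_spec, h a ha]

/-- The coefficient of `T ^ k`. -/
def paramCoeff (k : ℕ) : K[X]⟦X⟧ →+ K⟦X⟧ where
  toFun u := PowerSeries.mk fun j => (PowerSeries.coeff j u).coeff k
  map_zero' := by ext; simp
  map_add' u v := by ext; simp

theorem coeff_paramCoeff (k j : ℕ) (u : K[X]⟦X⟧) :
    PowerSeries.coeff j (paramCoeff k u) = (PowerSeries.coeff j u).coeff k := by
  simp [paramCoeff]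

theorem paramCoeff_ext {u v : K[X]⟦X⟧} (h : ∀ k, paramCoeff k u = paramCoeff k v) : u = v := by
  ext j k
  rw [← coeff_paramCoeff, h, coeff_paramCoeff]

theorem paramCoeff_mul (k : ℕ) (u v : K[X]⟦X⟧) :
    paramCoeff k (u * v) =
      ∑ p ∈ Finset.HasAntidiagonal.antidiagonal k, paramCoeff p.1 u * paramCoeff p.2 v := by
  ext j
  simp only [coeff_paramCoeff, PowerSeries.coeff_mul, Polynomial.finsetSum_coeff,
    Polynomial.coeff_mul, map_sum]
  rw [Finset.sum_comm]

theorem paramCoeff_derivative (k : ℕ) (u : K[X]⟦X⟧) :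
    paramCoeff k (PowerSeries.derivative K[X] u) = PowerSeries.derivative K (paramCoeff k u) := by
  ext j
  simp only [coeff_paramCoeff, PowerSeries.coeff_derivative]
  rw [show ((j : K[X]) + 1) = Polynomial.C ((j : K) + 1) by simp, Polynomial.coeff_mul_C]

/-- The constant family attached to a power series. -/
def constFamily : K⟦X⟧ →ₐ[K] K[X]⟦X⟧ where
  __ := PowerSeries.map Polynomial.C
  commutes' r := by
    change PowerSeries.map Polynomial.C (PowerSeries.C r) = _
    rw [PowerSeries.map_C, PowerSeries.algebraMap_apply]
    rfl

theorem coeff_constFamily (j : ℕ) (g : K⟦X⟧) :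
    PowerSeries.coeff j (constFamily g) = Polynomial.C (PowerSeries.coeff j g) := rfl

theorem derivative_constFamily (g : K⟦X⟧) :
    PowerSeries.derivative K[X] (constFamily g) = constFamily (PowerSeries.derivative K g) := by
  ext1 j
  simp [PowerSeries.coeff_derivative, coeff_constFamily]

theorem spec_constFamily (a : K) (g : K⟦X⟧) : spec a (constFamily g) = g := by
  ext j
  simp [coeff_spec, coeff_constFamily]

theorem spec_derivative (a : K) (u : K[X]⟦X⟧) :
    spec a (PowerSeries.derivative K[X] u) = PowerSeries.derivative K (spec a u) := by
  ext j
  simp [coeff_spec, PowerSeries.coeff_derivative]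

theorem paramCoeff_constFamily_mul (k : ℕ) (g : K⟦X⟧) (u : K[X]⟦X⟧) :
    paramCoeff k (constFamily g * u) = g * paramCoeff k u := by
  ext j
  simp [coeff_paramCoeff, PowerSeries.coeff_mul, Polynomial.finsetSum_coeff, coeff_constFamily]

theorem paramCoeff_zero (u : K[X]⟦X⟧) : paramCoeff 0 u = spec 0 u := by
  ext j
  rw [coeff_paramCoeff, coeff_spec, Polynomial.coeff_zero_eq_eval_zero]

/-- The derivative with respect to the parameter `T`. -/
def paramDeriv (u : K[X]⟦X⟧) : K[X]⟦X⟧ :=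
  PowerSeries.mk fun j => Polynomial.derivative (PowerSeries.coeff j u)

theorem paramCoeff_paramDeriv (k : ℕ) (u : K[X]⟦X⟧) :
    paramCoeff k (paramDeriv u) = ((k : K) + 1) • paramCoeff (k + 1) u := by
  ext j
  simp [coeff_paramCoeff, paramDeriv, Polynomial.coeff_derivative, mul_comm]

/-- No continuity of `D` is assumed: writing `g = X u + c` gives `D g = X · D u`, so `D g` is
divisible by every power of `X`. -/
theorem derivation_eq_zero_of_X {D : Derivation K K⟦X⟧ K⟦X⟧} (hD : D PowerSeries.X = 0) :
    D = 0 := by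
  have h1 : ∀ m g, PowerSeries.X ^ m ∣ D g := by
    intro m
    induction m with
    | zero => simp
    | succ m ih =>
      intro g
      conv_rhs => rw [PowerSeries.eq_X_mul_shift_add_const g]
      rw [map_add, D.leibniz, hD, smul_zero, add_zero, smul_eq_mul, pow_succ']
      rw [show D (PowerSeries.C (PowerSeries.constantCoeff g)) = 0 from D.map_algebraMap _,
        add_zero]
      exact mul_dvd_mul_left _ (ih _)
  ext g j
  simpa using PowerSeries.X_pow_dvd_iff.1 (h1 (j + 1) g) j (Nat.lt_succ_self j)

section Flow

variable [Algebra ℚ K]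

/-- The family `T ↦ σ ^ T` of iterates of `σ`, applied to `g`. -/
def flowFun (σ : K⟦X⟧ →ₐ[K] K⟦X⟧) (g : K⟦X⟧) : K[X]⟦X⟧ :=
  PowerSeries.mk fun j => ∑ k ∈ Finset.range (j + 1),
    Polynomial.C (PowerSeries.coeff j ((delta σ ^ k) g)) * binomPoly K k

variable {σ : K⟦X⟧ →ₐ[K] K⟦X⟧}

theorem spec_flowFun (hσ : IsUnipotent σ) (n : ℕ) (g : K⟦X⟧) :
    spec (n : K) (flowFun σ g) = (σ ^ n) g := by
  ext j
  rw [coeff_spec, flowFun, PowerSeries.coeff_mk, Polynomial.eval_finsetSum,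
    iterate_eq_sum_delta_pow, map_sum]
  simp only [Polynomial.eval_mul, Polynomial.eval_C, eval_binomPoly, PowerSeries.coeff_smul,
    mul_comm (PowerSeries.coeff _ _)]
  -- A common range for both sums: the terms with `k > j` vanish by unipotence, those with `k > n`
  -- because the binomial coefficient does.
  trans ∑ k ∈ Finset.range (j + n + 1), (n.choose k : K) * PowerSeries.coeff j ((delta σ ^ k) g)
  · refine Finset.sum_subset (Finset.range_mono (by omega)) fun k _ hk => ?_
    rw [hσ.coeff_delta_pow g (by simpa using hk), mul_zero]
  · refine (Finset.sum_subset (Finset.range_mono (by omega)) fun k _ hk => ?_).symm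
    rw [Nat.choose_eq_zero_of_lt (by simpa using hk), Nat.cast_zero, zero_mul]

variable [IsDomain K]

theorem infinite_range_natCast (K : Type*) [CommRing K] [Algebra ℚ K] [IsDomain K] :
    (Set.range ((↑) : ℕ → K)).Infinite := by
  have := algebraRat.charZero K
  exact Set.infinite_range_of_injective Nat.cast_injective

theorem spec_natCast_ext {u v : K[X]⟦X⟧} (h : ∀ n : ℕ, spec (n : K) u = spec (n : K) v) : u = v :=
  spec_ext (infinite_range_natCast K) (by rintro _ ⟨n, rfl⟩; exact h n)

/-- The family `T ↦ σ ^ T` of iterates of a unipotent `σ`. -/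
def flow (hσ : IsUnipotent σ) : K⟦X⟧ →ₐ[K] K[X]⟦X⟧ where
  toFun := flowFun σ
  map_zero' := spec_natCast_ext fun n => by simp [spec_flowFun hσ]
  map_one' := spec_natCast_ext fun n => by simp [spec_flowFun hσ]
  map_add' g₁ g₂ := spec_natCast_ext fun n => by simp [spec_flowFun hσ]
  map_mul' g₁ g₂ := spec_natCast_ext fun n => by simp [spec_flowFun hσ]
  commutes' r := spec_natCast_ext fun n => by
    rw [spec_flowFun hσ, AlgHom.commutes, ← AlgHom.commutes constFamily, spec_constFamily]

theorem spec_flow (hσ : IsUnipotent σ) (n : ℕ) (g : K⟦X⟧) :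
    spec (n : K) (flow hσ g) = (σ ^ n) g :=
  spec_flowFun hσ n g

theorem paramCoeff_zero_flow (hσ : IsUnipotent σ) (g : K⟦X⟧) :
    paramCoeff 0 (flow hσ g) = g := by
  rw [paramCoeff_zero]
  simpa using spec_flow hσ 0 g

theorem flow_injective (hσ : IsUnipotent σ) : Function.Injective (flow hσ) := fun g₁ g₂ h => by
  rw [← paramCoeff_zero_flow hσ g₁, h, paramCoeff_zero_flow]

/-- The cutoff `N` may exceed `j`, so that one truncated logarithm serves all coefficients up to
`N`. -/
theorem coeff_paramCoeff_one_flow (hσ : IsUnipotent σ) (g : K⟦X⟧) {j N : ℕ} (hj : j ≤ N) :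
    PowerSeries.coeff j (paramCoeff 1 (flow hσ g)) =
      PowerSeries.coeff j (∑ n ∈ Finset.Icc 1 N,
        algebraMap ℚ K ((-1) ^ (n + 1) / (n : ℚ)) • (delta σ ^ n) g) := by
  have h1 : PowerSeries.coeff j (paramCoeff 1 (flow hσ g)) =
      ∑ k ∈ Finset.range (N + 1),
        PowerSeries.coeff j ((delta σ ^ k) g) * (binomPoly K k).coeff 1 := by
    rw [coeff_paramCoeff]
    change (PowerSeries.coeff j (flowFun σ g)).coeff 1 = _
    rw [flowFun, PowerSeries.coeff_mk, Polynomial.finsetSum_coeff]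
    simp only [Polynomial.coeff_C_mul]
    refine Finset.sum_subset (Finset.range_mono (by omega)) fun k _ hk => ?_
    rw [hσ.coeff_delta_pow g (by simpa using hk), zero_mul]
  rw [h1, Finset.sum_range_succ', coeff_one_binomPoly_zero, mul_zero, add_zero, map_sum,
    show Finset.Icc 1 N = Finset.Ico 1 (N + 1) from rfl, Finset.sum_Ico_eq_sum_range]
  refine Finset.sum_congr rfl fun k _ => ?_
  rw [add_comm 1 k, coeff_one_binomPoly_succ, PowerSeries.coeff_smul, mul_comm, pow_add (-1) k 2]
  simp

/-- The infinitesimal generator `log σ`. -/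
def generator (hσ : IsUnipotent σ) : Derivation K K⟦X⟧ K⟦X⟧ :=
  Derivation.mk'
    { toFun := fun g => paramCoeff 1 (flow hσ g)
      map_add' := by simp
      map_smul' := fun r g => by
        rw [map_smul, Algebra.smul_def, ← AlgHom.commutes constFamily,
          paramCoeff_constFamily_mul, ← Algebra.smul_def, RingHom.id_apply] }
    fun a b => by
      simp [paramCoeff_mul, Finset.Nat.antidiagonal_succ, paramCoeff_zero_flow]
      ring

theorem generator_apply (hσ : IsUnipotent σ) (g : K⟦X⟧) :
    generator hσ g = paramCoeff 1 (flow hσ g) := rfl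

theorem generator_eq (hσ : IsUnipotent σ) (g : K⟦X⟧) :
    generator hσ g = generator hσ PowerSeries.X * PowerSeries.derivative K g := by
  have := derivation_eq_zero_of_X
    (D := generator hσ - generator hσ PowerSeries.X • PowerSeries.derivative K) (by simp)
  have := DFunLike.congr_fun this g
  simpa [sub_eq_zero] using this

/-- Modulo `X ^ (j + 1)` the generator is a polynomial in `δ`, which commutes with `σ`; and `σ`
preserves that congruence. -/
theorem generator_map (hσ : IsUnipotent σ) (g : K⟦X⟧) :
    generator hσ (σ g) = σ (generator hσ g) := by
  ext j
  set S : K⟦X⟧ → K⟦X⟧ := fun g => ∑ n ∈ Finset.Icc 1 j,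
        algebraMap ℚ K ((-1) ^ (n + 1) / (n : ℚ)) • (delta σ ^ n) g with hS
  have h1 : σ (S g) = S (σ g) := by
    simp only [hS, map_sum, map_smul]
    refine Finset.sum_congr rfl fun n _ => ?_
    have hc : Commute (delta σ) σ.toLinearMap := by
      rw [delta]
      exact (Commute.refl _).sub_left (Commute.one_left _)
    congr 1
    exact (DFunLike.congr_fun (hc.pow_left n).eq g).symm
  have h2 : PowerSeries.X ^ (j + 1) ∣ generator hσ g - S g := by
    rw [PowerSeries.X_pow_dvd_iff]
    intro m hm
    rw [map_sub, sub_eq_zero]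
    exact coeff_paramCoeff_one_flow hσ g (Nat.lt_succ_iff.1 hm)
  have h3 := PowerSeries.X_pow_dvd_iff.1 (hσ.X_pow_dvd_map h2) j (Nat.lt_succ_self j)
  rw [map_sub, h1, map_sub, sub_eq_zero] at h3
  rw [h3]
  exact coeff_paramCoeff_one_flow hσ (σ g) le_rfl

theorem generator_pow_map (hσ : IsUnipotent σ) (n : ℕ) (g : K⟦X⟧) :
    generator hσ ((σ ^ n) g) = (σ ^ n) (generator hσ g) := by
  induction n with
  | zero => simp
  | succ n ih =>
    rw [pow_succ', AlgHom.mul_apply, AlgHom.mul_apply, generator_map, ih]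

/-- By the group law `h1`, `σ^(T+n) = σ^T σ^n`, the derivative at `T = n` is the derivative at `T =
0` of the flow of `σ^n g`. -/
theorem spec_paramDeriv_flow (hσ : IsUnipotent σ) (n : ℕ) (g : K⟦X⟧) :
    spec (n : K) (paramDeriv (flow hσ g)) = generator hσ ((σ ^ n) g) := by
  have h1 : ∀ j, (PowerSeries.coeff j (flow hσ g)).comp (Polynomial.X + Polynomial.C (n : K)) =
      PowerSeries.coeff j (flow hσ ((σ ^ n) g)) := by
    intro j
    refine Polynomial.eq_of_infinite_eval_eq _ _
      ((infinite_range_natCast K).mono ?_)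
    rintro _ ⟨m, rfl⟩
    have h2 := spec_flow hσ (m + n) g
    rw [pow_add, AlgHom.mul_apply, ← spec_flow hσ m] at h2
    have h3 := congrArg (PowerSeries.coeff j) h2
    simpa [coeff_spec] using h3
  ext j
  rw [coeff_spec, generator_apply, coeff_paramCoeff, ← h1, paramDeriv, PowerSeries.coeff_mk]
  have h4 := Polynomial.coeff_derivative
    ((PowerSeries.coeff j (flow hσ g)).comp (Polynomial.X + Polynomial.C (n : K))) 0
  rw [Polynomial.derivative_comp, Polynomial.coeff_zero_eq_eval_zero] at h4
  simpa using h4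

theorem paramDeriv_flow (hσ : IsUnipotent σ) (g : K⟦X⟧) :
    paramDeriv (flow hσ g) = flow hσ (generator hσ g) :=
  spec_natCast_ext fun n => by rw [spec_paramDeriv_flow, spec_flow, generator_pow_map]

theorem paramDeriv_flow' (hσ : IsUnipotent σ) (g : K⟦X⟧) :
    paramDeriv (flow hσ g) = constFamily (generator hσ PowerSeries.X) *
      PowerSeries.derivative K[X] (flow hσ g) :=
  spec_natCast_ext fun n => by
    rw [spec_paramDeriv_flow, map_mul, spec_constFamily, spec_derivative, spec_flow, generator_eq]

/-- Julia's equation. -/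
theorem flow_generator_X (hσ : IsUnipotent σ) :
    flow hσ (generator hσ PowerSeries.X) = constFamily (generator hσ PowerSeries.X) *
      PowerSeries.derivative K[X] (flow hσ PowerSeries.X) := by
  rw [← paramDeriv_flow, paramDeriv_flow']

/-- The chain rule, obtained by cancelling `f_*` after differentiating in `T`, using `∂φ(g)/∂T =
φ(f_* g') = φ(f_*) φ(g')` and Julia's equation. -/
theorem derivative_flow (hσ : IsUnipotent σ) (h0 : generator hσ PowerSeries.X ≠ 0) (g : K⟦X⟧) :
    PowerSeries.derivative K[X] (flow hσ g) =
      PowerSeries.derivative K[X] (flow hσ PowerSeries.X) *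
        flow hσ (PowerSeries.derivative K g) := by
  have h1 : constFamily (generator hσ PowerSeries.X) ≠ 0 := fun h =>
    h0 (by rw [← spec_constFamily 0 (generator hσ PowerSeries.X), h, map_zero])
  refine mul_left_cancel₀ h1 ?_
  rw [← paramDeriv_flow', paramDeriv_flow, generator_eq, map_mul, flow_generator_X, mul_assoc]

end Flow

end

/-! ### The iteration matrix and the iterative logarithm -/

section

variable {K : Type*} [CommRing K]

theorem IsUnitary.hasSubst {f : K⟦X⟧} (hf : IsUnitary f) : PowerSeries.HasSubst f :=
  PowerSeries.HasSubst.of_constantCoeff_zero' (by simpa using hf.1)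

/-- Composition with `f`, as an endomorphism of the algebra of power series. -/
def compHom {f : K⟦X⟧} (hf : IsUnitary f) : K⟦X⟧ →ₐ[K] K⟦X⟧ :=
  PowerSeries.substAlgHom hf.hasSubst

theorem compHom_apply {f : K⟦X⟧} (hf : IsUnitary f) (g : K⟦X⟧) :
    compHom hf g = PowerSeries.subst f g := by
  rw [compHom, PowerSeries.coe_substAlgHom]

theorem compHom_X {f : K⟦X⟧} (hf : IsUnitary f) : compHom hf PowerSeries.X = f := by
  rw [compHom_apply, PowerSeries.subst_X hf.hasSubst]

theorem iterate_eq_compHom_pow {f : K⟦X⟧} (hf : IsUnitary f) (n : ℕ) :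
    iterate f n = (compHom hf ^ n) PowerSeries.X := by
  induction n with
  | zero => rfl
  | succ n ih => rw [iterate, ih, pow_succ', AlgHom.mul_apply, compHom_apply]

theorem IsUnitary.X_dvd {f : K⟦X⟧} (hf : IsUnitary f) : PowerSeries.X ∣ f :=
  PowerSeries.X_dvd_iff.2 (by simpa using hf.1)

theorem IsUnitary.coeff_pow_eq_zero {f : K⟦X⟧} (hf : IsUnitary f) {j k : ℕ} (h : j < k) :
    PowerSeries.coeff j (f ^ k) = 0 :=
  PowerSeries.X_pow_dvd_iff.1 (pow_dvd_pow_of_dvd hf.X_dvd k) j h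

theorem coeff_compHom {f : K⟦X⟧} (hf : IsUnitary f) (g : K⟦X⟧) (j : ℕ) :
    PowerSeries.coeff j (compHom hf g) =
      ∑ k ∈ Finset.range (j + 1), PowerSeries.coeff k g * PowerSeries.coeff j (f ^ k) := by
  rw [compHom_apply, PowerSeries.coeff_subst' hf.hasSubst]
  refine finsum_eq_sum_of_support_subset _ fun k hk => ?_
  by_contra h
  refine hk ?_
  simp only [smul_eq_mul]
  rw [hf.coeff_pow_eq_zero (by simpa using h), mul_zero]

theorem isUnipotent_compHom {f : K⟦X⟧} (hf : IsUnitary f) : IsUnipotent (compHom hf) := by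
  rintro k _ ⟨u, rfl⟩
  obtain ⟨v, hv⟩ := hf.X_dvd
  have hv1 : PowerSeries.constantCoeff v = 1 := by
    have := hf.2
    rw [hv, show (1 : ℕ) = 0 + 1 from rfl, PowerSeries.coeff_succ_X_mul] at this
    simpa using this
  have hu : PowerSeries.constantCoeff (compHom hf u) = PowerSeries.constantCoeff u := by
    have := coeff_compHom hf u 0
    simpa using this
  rw [map_mul, map_pow, compHom_X]
  nth_rw 1 [hv]
  rw [mul_pow, mul_assoc, ← mul_sub, pow_succ]
  refine mul_dvd_mul_left _ (PowerSeries.X_dvd_iff.2 ?_)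
  simp [hv1, hu]

/-- A row is the coefficient sequence of a series; right multiplication by `[f] - 1` applies `δ` to
that series. -/
theorem triPow_iterationMatrix {f : K⟦X⟧} (hf : IsUnitary f) (n i j : ℕ) :
    triPow (iterationMatrix f - 1) n i j =
      PowerSeries.coeff j ((delta (compHom hf) ^ n) (PowerSeries.X ^ i)) := by
  induction n generalizing j with
  | zero =>
    simp [triPow, Matrix.one_apply, PowerSeries.coeff_X_pow, eq_comm]
  | succ n ih =>
    rw [triPow, triMul, pow_succ', Module.End.mul_apply, delta_apply, map_sub, coeff_compHom]
    simp only [ih, Matrix.sub_apply, mul_sub, Finset.sum_sub_distrib, iterationMatrix,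
      Matrix.one_apply, mul_ite, mul_one, mul_zero]
    simp

theorem IsIterativeLogarithm.unique [Algebra ℚ K] {f h₁ h₂ : K⟦X⟧} (H₁ : IsIterativeLogarithm f h₁)
    (H₂ : IsIterativeLogarithm f h₂) : h₁ = h₂ := by
  ext j
  rcases j with _ | j
  · rw [PowerSeries.X_pow_dvd_iff.1 H₁.1 0 (by simp), PowerSeries.X_pow_dvd_iff.1 H₂.1 0 (by simp)]
  -- Row `1` of `⟨h⟩` lists the coefficients of `h` themselves.
  · have := congrFun (congrFun (H₁.2.symm.trans H₂.2) 1) (j + 1)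
    simpa [infinitesimalMatrix] using this

section

variable [Algebra ℚ K] [IsDomain K]

/-- The infinitesimal generator of the iterates of `f`. -/
def iterLog {f : K⟦X⟧} (hf : IsUnitary f) : K⟦X⟧ :=
  generator (isUnipotent_compHom hf) PowerSeries.X

theorem X_sq_dvd_iterLog {f : K⟦X⟧} (hf : IsUnitary f) : PowerSeries.X ^ 2 ∣ iterLog hf := by
  rw [PowerSeries.X_pow_dvd_iff]
  intro j hj
  rw [iterLog, generator_apply, coeff_paramCoeff_one_flow _ _ (Nat.lt_succ_iff.1 hj)]
  have h1 := PowerSeries.X_pow_dvd_iff.1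
    (isUnipotent_compHom hf 1 PowerSeries.X (by simp)) j hj
  rw [← delta_apply] at h1
  simp [h1]

theorem isIterativeLogarithm_iterLog {f : K⟦X⟧} (hf : IsUnitary f) :
    IsIterativeLogarithm f (iterLog hf) := by
  refine ⟨X_sq_dvd_iterLog hf, ?_⟩
  ext i j
  have h1 : triLog (iterationMatrix f) i j = PowerSeries.coeff j
      (generator (isUnipotent_compHom hf) (PowerSeries.X ^ i)) := by
    rw [generator_apply, coeff_paramCoeff_one_flow _ _ le_rfl, triLog, map_sum]
    refine Finset.sum_congr rfl fun n _ => ?_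
    rw [triPow_iterationMatrix hf, PowerSeries.coeff_smul, Algebra.smul_def, smul_eq_mul]
  rw [h1, generator_eq, ← iterLog, infinitesimalMatrix]
  rcases i with _ | i
  · simp
  · rw [PowerSeries.derivative_pow, PowerSeries.derivative_X, mul_one, Nat.add_sub_cancel,
      ← map_natCast (PowerSeries.C (R := K)), mul_left_comm, PowerSeries.coeff_C_mul,
      PowerSeries.coeff_mul_X_pow']
    split_ifs with h2 h3 h3
    · congr 2
      congr 1
      omega
    -- Here `j = i` in row `i + 1`, just below the diagonal; the entry is a multiple of the constant
    -- coefficient of `f_*`.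
    · rw [show j - i = 0 by omega, PowerSeries.X_pow_dvd_iff.1 (X_sq_dvd_iterLog hf) 0 (by simp),
        mul_zero]
    · omega
    · simp

/-- The family `f^[T]` of iterates with indeterminate exponent `T`. -/
def iterFlow {f : K⟦X⟧} (hf : IsUnitary f) : K[X]⟦X⟧ :=
  flow (isUnipotent_compHom hf) PowerSeries.X

theorem spec_iterFlow {f : K⟦X⟧} (hf : IsUnitary f) (n : ℕ) :
    spec (n : K) (iterFlow hf) = iterate f n := by
  rw [iterFlow, spec_flow, iterate_eq_compHom_pow]

theorem paramCoeff_zero_iterFlow {f : K⟦X⟧} (hf : IsUnitary f) :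
    paramCoeff 0 (iterFlow hf) = PowerSeries.X :=
  paramCoeff_zero_flow _ _

/-- Compare coefficients of `T ^ k` in `∂f^[T]/∂T = f_* · ∂f^[T]/∂z`. This recursion determines
`f^[T]` from `f_*`. -/
theorem paramCoeff_succ_iterFlow {f : K⟦X⟧} (hf : IsUnitary f) (k : ℕ) :
    ((k : K) + 1) • paramCoeff (k + 1) (iterFlow hf) =
      iterLog hf * PowerSeries.derivative K (paramCoeff k (iterFlow hf)) := by
  rw [← paramCoeff_paramDeriv, iterFlow, paramDeriv_flow', paramCoeff_constFamily_mul,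
    paramCoeff_derivative, iterLog]

end

end

/-! ### Differentially algebraic `f_*`: coherence -/

section

section Algebraic

variable {K A : Type*} [CommRing K] [CommRing A] [Algebra K A]

theorem isAlgebraic_adjoin_map {A' : Type*} [CommRing A'] [Algebra K A'] (ψ : A →ₐ[K] A')
    (hψ : Function.Injective ψ) {s : Set A} {t : Set A'} (hst : Set.MapsTo ψ s t) {a : A}
    (ha : IsAlgebraic (Algebra.adjoin K s) a) : IsAlgebraic (Algebra.adjoin K t) (ψ a) := by
  have h1 : ∀ x : Algebra.adjoin K s, ψ x ∈ Algebra.adjoin K t := by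
    have : (Algebra.adjoin K s).map ψ ≤ Algebra.adjoin K t := by
      rw [AlgHom.map_adjoin]
      exact Algebra.adjoin_mono hst.image_subset
    exact fun x => this ⟨x, x.2, rfl⟩
  refine ha.ringHom_of_comp_eq
    ((ψ.comp (Algebra.adjoin K s).val).codRestrict (Algebra.adjoin K t) h1) ψ ?_ ?_
  · intro x y h
    exact Subtype.ext (hψ (congrArg Subtype.val h))
  · rfl

theorem exists_isAlgebraic_of_not_algebraicIndependent
    (hinj : Function.Injective (algebraMap K A)) {y : ℕ → A} (hy : ¬ AlgebraicIndependent K y) :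
    ∃ n, IsAlgebraic (Algebra.adjoin K (y '' Set.Iio n)) (y n) := by
  by_contra! H
  have h1 : ∀ n, AlgebraicIndepOn K y (Set.Iio n) := by
    intro n
    induction n with
    | zero =>
      have : IsEmpty (Set.Iio 0 : Set ℕ) := ⟨fun x => Nat.not_lt_zero _ x.2⟩
      exact algebraicIndependent_empty_type_iff.2 hinj
    | succ n ih =>
      rw [show Set.Iio (n + 1) = insert n (Set.Iio n) by ext; simp [Nat.le_iff_lt_or_eq, or_comm]]
      exact ih.insert (H n)
  refine hy (algebraicIndependent_of_finite_type fun t ht => ?_)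
  obtain ⟨n, hn⟩ := ht.bddAbove
  exact (h1 (n + 1)).mono fun i hi => Nat.lt_succ_iff.2 (hn hi)

variable [IsDomain A]

theorem exists_derivation_aeval {B : Subalgebra K A} (D : Derivation K A A)
    (hD : ∀ b : B, IsAlgebraic B (D b)) {a : A} (ha : IsAlgebraic B a) (p : B[X]) :
    ∃ e, IsAlgebraic B e ∧
      D (Polynomial.aeval a p) = Polynomial.aeval a (Polynomial.derivative p) * D a + e := by
  induction p using Polynomial.induction_on' with
  | add p q hp hq =>
    obtain ⟨e₁, h₁, hp⟩ := hp
    obtain ⟨e₂, h₂, hq⟩ := hq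
    exact ⟨e₁ + e₂, h₁.add h₂, by simp only [map_add, hp, hq]; ring⟩
  | monomial n b =>
    refine ⟨D b * a ^ n, (hD b).mul (ha.pow n), ?_⟩
    rw [Polynomial.derivative_monomial, Polynomial.aeval_monomial, Polynomial.aeval_monomial,
      D.leibniz, D.leibniz_pow]
    simp only [smul_eq_mul, nsmul_eq_mul, map_mul, map_natCast,
      show algebraMap B A b = (b : A) from rfl]
    ring

/-- The elements algebraic over `B` are stable under a derivation if it maps generators of `B` to
elements algebraic over `B`. -/
theorem isAlgebraic_derivation [CharZero A] (D : Derivation K A A) {s : Set A}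
    (hs : ∀ x ∈ s, IsAlgebraic (Algebra.adjoin K s) (D x)) {a : A}
    (ha : IsAlgebraic (Algebra.adjoin K s) a) : IsAlgebraic (Algebra.adjoin K s) (D a) := by
  have hB : ∀ b ∈ Algebra.adjoin K s, IsAlgebraic (Algebra.adjoin K s) b := fun b hb =>
    isAlgebraic_algebraMap (⟨b, hb⟩ : Algebra.adjoin K s)
  have hD : ∀ b ∈ Algebra.adjoin K s, IsAlgebraic (Algebra.adjoin K s) (D b) := by
    intro b hb
    induction hb using Algebra.adjoin_induction with
    | mem x hx => exact hs x hx
    | algebraMap r => rw [D.map_algebraMap]; exact isAlgebraic_zero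
    | add x y _ _ hx hy => rw [map_add]; exact hx.add hy
    | mul x y hx' hy' hx hy =>
      rw [D.leibniz]
      exact ((hB x hx').mul hy).add ((hB y hy').mul hx)
  have hinj : Function.Injective (algebraMap (Algebra.adjoin K s) A) := Subtype.val_injective
  have : IsDomain (Algebra.adjoin K s) := hinj.isDomain _
  have : CharZero (Algebra.adjoin K s) := ⟨fun m n h => by
    have := congrArg (algebraMap (Algebra.adjoin K s) A) h
    simpa using this⟩
  -- Descent on the degree replaces a minimal polynomial: either `p'` also kills `a`, or `p'(a) · D
  -- a = -e` with `e` algebraic and `p'(a) ≠ 0`.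
  have key : ∀ n, ∀ p : (Algebra.adjoin K s)[X], p.natDegree = n → p ≠ 0 →
      Polynomial.aeval a p = 0 → IsAlgebraic (Algebra.adjoin K s) (D a) := by
    intro n
    induction n using Nat.strong_induction_on with
    | _ n ih =>
      intro p hn hp0 hp
      have hn0 : p.natDegree ≠ 0 := by
        intro h
        rw [Polynomial.eq_C_of_natDegree_eq_zero h] at hp hp0
        rw [Polynomial.aeval_C, map_eq_zero_iff _ hinj] at hp
        exact hp0 (by rw [hp, Polynomial.C_0])
      by_cases hd : Polynomial.aeval a (Polynomial.derivative p) = 0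
      · refine ih _ (hn ▸ Polynomial.natDegree_derivative_lt hn0) _ rfl ?_ hd
        exact fun h => hn0 (Polynomial.derivative_eq_zero.1 h)
      · obtain ⟨e, he, hDe⟩ := exists_derivation_aeval D (fun b => hD b b.2) ha p
        rw [hp, map_zero] at hDe
        refine IsAlgebraic.of_mul (mem_nonZeroDivisors_of_ne_zero hd) ?_
          (eq_neg_of_add_eq_zero_left hDe.symm ▸ he.neg)
        refine Polynomial.aeval_mem_adjoin_singleton _ a |> fun h =>
          Algebra.isAlgebraic_adjoin_singleton_iff.2 ha _ h
  obtain ⟨p, hp0, hp⟩ := ha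
  exact key _ p rfl hp0 hp

/-- In the matroid of algebraic independence, the closure of a finite set has finite rank. -/
theorem not_algebraicIndependent_of_finite [FaithfulSMul K A] {s : Set A} (hs : s.Finite)
    {y : ℕ → A} (hy : ∀ n, IsAlgebraic (Algebra.adjoin K s) (y n)) :
    ¬ AlgebraicIndependent K y := by
  intro h
  have : IsDomain K := (FaithfulSMul.algebraMap_injective K A).isDomain _
  have h1 : (AlgebraicIndependent.matroid K A).Indep (Set.range y) :=
    AlgebraicIndependent.matroid_indep_iff.2 h.to_subtype_range
  have h2 : Set.range y ⊆ (AlgebraicIndependent.matroid K A).closure s := by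
    rw [AlgebraicIndependent.matroid_closure_eq]
    rintro _ ⟨n, rfl⟩
    exact hy n
  have h3 := h1.encard_le_eRk_of_subset h2
  rw [Matroid.eRk_closure_eq] at h3
  have h4 := h3.trans (Matroid.eRk_le_encard _ _)
  exact Set.infinite_range_of_injective h.injective
    (Set.encard_lt_top_iff.1 (h4.trans_lt (Set.encard_lt_top_iff.2 hs)))

/-- Let `φ` and `c` be two embeddings of a differential ring which satisfy the chain rule and
Julia's equation. Then `φ x` and its derivatives are algebraically dependent. -/
theorem not_algebraicIndependent_of_julia [CharZero A] [FaithfulSMul K A] {A₀ : Type*}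
    [CommRing A₀] [Algebra K A₀] {D₀ : A₀ → A₀} (D : Derivation K A A) {c φ : A₀ →ₐ[K] A}
    (hc : Function.Injective c) (hφ : Function.Injective φ) {s : Set A₀} (hsfin : s.Finite)
    (hs : ∀ a ∈ s, IsAlgebraic (Algebra.adjoin K s) (D₀ a)) {h x : A₀}
    (hx : x ∈ s) (hh : IsAlgebraic (Algebra.adjoin K s) h) (h0 : h ≠ 0)
    (hDc : ∀ a, D (c a) = c (D₀ a)) (hDφ : ∀ a, D (φ a) = D (φ x) * φ (D₀ a))
    (hjulia : φ h = c h * D (φ x)) :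
    ¬ AlgebraicIndependent K (fun n => D^[n] (φ x)) := by
  set t : Set A := c '' s ∪ φ '' s with ht
  have hcalg : ∀ {a}, IsAlgebraic (Algebra.adjoin K s) a →
      IsAlgebraic (Algebra.adjoin K t) (c a) := fun ha =>
    isAlgebraic_adjoin_map c hc (fun x hx => Or.inl (Set.mem_image_of_mem _ hx)) ha
  have hφalg : ∀ {a}, IsAlgebraic (Algebra.adjoin K s) a →
      IsAlgebraic (Algebra.adjoin K t) (φ a) := fun ha =>
    isAlgebraic_adjoin_map φ hφ (fun x hx => Or.inr (Set.mem_image_of_mem _ hx)) ha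
  -- Julia's equation gives `D (φ x)` as the quotient of `φ h` by `c h ≠ 0`.
  have hy1 : IsAlgebraic (Algebra.adjoin K t) (D (φ x)) := by
    refine IsAlgebraic.of_mul (y := c h) ?_ (hcalg hh) (hjulia ▸ hφalg hh)
    exact mem_nonZeroDivisors_of_ne_zero ((map_ne_zero_iff _ hc).2 h0)
  have hder : ∀ a ∈ t, IsAlgebraic (Algebra.adjoin K t) (D a) := by
    rintro _ (⟨a, ha, rfl⟩ | ⟨a, ha, rfl⟩)
    · rw [hDc]
      exact hcalg (hs a ha)
    · rw [hDφ]
      exact hy1.mul (hφalg (hs a ha))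
  refine not_algebraicIndependent_of_finite ((hsfin.image _).union (hsfin.image _)) (s := t)
    fun n => ?_
  induction n with
  | zero =>
    have : φ x ∈ Algebra.adjoin K t := Algebra.subset_adjoin (Or.inr ⟨x, hx, rfl⟩)
    exact isAlgebraic_algebraMap (⟨_, this⟩ : Algebra.adjoin K t)
  | succ n ih =>
    rw [Function.iterate_succ_apply']
    exact isAlgebraic_derivation D hder ih

end Algebraic

variable {K : Type*} [CommRing K]

/-- Evaluation of a differential polynomial at a family of power series. -/
def DiffPoly.evalFamily (P : DiffPoly K) (y : K[X]⟦X⟧) : K[X]⟦X⟧ :=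
  MvPolynomial.eval₂
    ((constFamily (K := K)).toRingHom.comp (Polynomial.coeToPowerSeries.ringHom (R := K)))
    (fun n => (PowerSeries.derivative K[X])^[n] y) P

theorem spec_iterate_derivative (a : K) (n : ℕ) (y : K[X]⟦X⟧) :
    spec a ((PowerSeries.derivative K[X])^[n] y) = (PowerSeries.derivative K)^[n] (spec a y) := by
  induction n with
  | zero => rfl
  | succ n ih => rw [Function.iterate_succ_apply', spec_derivative, ih,
      Function.iterate_succ_apply']

theorem spec_evalFamily (a : K) (P : DiffPoly K) (y : K[X]⟦X⟧) :
    spec a (P.evalFamily y) = P.evalAt (spec a y) := by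
  rw [DiffPoly.evalFamily, MvPolynomial.hom_eval₂, DiffPoly.evalAt]
  congr 1
  · refine RingHom.ext fun p => ?_
    exact spec_constFamily _ _
  · funext n
    exact spec_iterate_derivative a n y

theorem constFamily_injective : Function.Injective (constFamily (K := K)) := fun g₁ g₂ h => by
  rw [← spec_constFamily 0 g₁, h, spec_constFamily]

theorem evalFamily_map_C (P : MvPolynomial ℕ K) (y : K[X]⟦X⟧) :
    DiffPoly.evalFamily (MvPolynomial.map Polynomial.C P) y =
      MvPolynomial.aeval (fun n => (PowerSeries.derivative K[X])^[n] y) P := by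
  rw [DiffPoly.evalFamily, MvPolynomial.eval₂_map, MvPolynomial.aeval_def]
  congr 1
  refine RingHom.ext fun r => ?_
  simp only [RingHom.comp_apply, Polynomial.coeToPowerSeries.ringHom_apply, Polynomial.coe_C]
  exact constFamily.commutes r

section

variable [IsDomain K]

/-- Take `s = {X, h, …, h^(n-1)}`, where `h^(n)` is the first derivative found algebraic over its
predecessors. Putting `X` into `s` lowers the base ring from `K[z]` to `K`. -/
theorem IsDiffAlgebraic.exists_finite {h : K⟦X⟧} (hh : IsDiffAlgebraic h) :
    ∃ s : Set K⟦X⟧, s.Finite ∧ PowerSeries.X ∈ s ∧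
      (∀ x ∈ s, IsAlgebraic (Algebra.adjoin K s) (PowerSeries.derivative K x)) ∧
      IsAlgebraic (Algebra.adjoin K s) h := by
  obtain ⟨P, hP0, hP⟩ := hh
  have halg : ∀ p : K[X], algebraMap K[X] K⟦X⟧ p = (p : K⟦X⟧) := by
    intro p
    rw [PowerSeries.algebraMap_apply']
    simp
  have hdep : ¬ AlgebraicIndependent K[X] (fun n => (PowerSeries.derivative K)^[n] h) := by
    intro hi
    refine hP0 ((algebraicIndependent_iff.1 hi) P ?_)
    rw [← hP, DiffPoly.evalAt, MvPolynomial.aeval_def]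
    congr 1
  obtain ⟨n, hn⟩ := exists_isAlgebraic_of_not_algebraicIndependent
    (fun p q hpq => Polynomial.coe_injective K (by rwa [halg, halg] at hpq)) hdep
  set y : ℕ → K⟦X⟧ := fun n => (PowerSeries.derivative K)^[n] h with hy
  set s : Set K⟦X⟧ := insert PowerSeries.X (y '' Set.Iio n) with hs
  have hmem : ∀ x ∈ Algebra.adjoin K s, IsAlgebraic (Algebra.adjoin K s) x := fun b hb =>
    isAlgebraic_algebraMap (⟨b, hb⟩ : Algebra.adjoin K s)
  have hX : PowerSeries.X ∈ Algebra.adjoin K s := Algebra.subset_adjoin (Set.mem_insert _ _)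
  have hle : ∀ x ∈ Algebra.adjoin K[X] (y '' Set.Iio n), x ∈ Algebra.adjoin K s := by
    intro x hx
    induction hx using Algebra.adjoin_induction with
    | mem x hx => exact Algebra.subset_adjoin (Set.mem_insert_of_mem _ hx)
    | algebraMap p =>
      rw [halg]
      induction p using Polynomial.induction_on' with
      | add p q hp hq => rw [Polynomial.coe_add]; exact add_mem hp hq
      | monomial m a =>
        rw [← Polynomial.C_mul_X_pow_eq_monomial, Polynomial.coe_mul, Polynomial.coe_pow,
          Polynomial.coe_X, Polynomial.coe_C]
        exact mul_mem (Subalgebra.algebraMap_mem _ a) (pow_mem hX m)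
    | add x y _ _ hx hy => exact add_mem hx hy
    | mul x y _ _ hx hy => exact mul_mem hx hy
  have hyn : IsAlgebraic (Algebra.adjoin K s) (y n) := by
    refine hn.ringHom_of_comp_eq ((Algebra.adjoin K[X] (y '' Set.Iio n)).val.toRingHom.codRestrict
      (Algebra.adjoin K s) fun x => hle _ x.2) (RingHom.id K⟦X⟧) ?_ rfl
    intro a b hab
    exact Subtype.ext (congrArg (fun x : Algebra.adjoin K s => (x : K⟦X⟧)) hab)
  have hder : ∀ x ∈ s, IsAlgebraic (Algebra.adjoin K s) (PowerSeries.derivative K x) := by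
    rintro _ (rfl | ⟨m, hm, rfl⟩)
    · rw [PowerSeries.derivative_X]
      exact isAlgebraic_one
    · have h1 : PowerSeries.derivative K (y m) = y (m + 1) :=
        (Function.iterate_succ_apply' _ _ _).symm
      rw [h1]
      rcases (Nat.succ_le_of_lt hm).lt_or_eq with h2 | h2
      · exact hmem _ (Algebra.subset_adjoin (Set.mem_insert_of_mem _ ⟨_, h2, rfl⟩))
      · rw [← Nat.succ_eq_add_one, h2]
        exact hyn
  refine ⟨s, ((Set.finite_Iio n).image y).insert _, Set.mem_insert _ _, hder, ?_⟩
  rcases Nat.eq_zero_or_pos n with rfl | h1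
  · exact hyn
  · exact hmem _ (Algebra.subset_adjoin (Set.mem_insert_of_mem _ ⟨0, h1, rfl⟩))

variable [Algebra ℚ K]

theorem isCoherent_iterates_of_evalFamily {f : K⟦X⟧} (hf : IsUnitary f) {P : DiffPoly K}
    (hP : P ≠ 0) (h : P.evalFamily (iterFlow hf) = 0) : IsCoherent (iterates f) := by
  refine ⟨P, hP, ?_⟩
  rintro _ ⟨n, rfl⟩
  rw [← spec_iterFlow hf, ← spec_evalFamily, h, map_zero]

theorem iterFlow_of_iterLog_eq_zero {f : K⟦X⟧} (hf : IsUnitary f) (h : iterLog hf = 0) :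
    iterFlow hf = constFamily PowerSeries.X := by
  have := algebraRat.charZero K
  refine paramCoeff_ext fun k => ?_
  rcases k with _ | k
  · rw [paramCoeff_zero_iterFlow, paramCoeff_zero, spec_constFamily]
  · have h1 := paramCoeff_succ_iterFlow hf k
    ext j
    have h2 := congrArg (PowerSeries.coeff j) h1
    rw [h, zero_mul, PowerSeries.coeff_smul, map_zero, smul_eq_mul] at h2
    rw [(mul_eq_zero.1 h2).resolve_left (Nat.cast_add_one_ne_zero k)]
    rw [coeff_paramCoeff, coeff_constFamily, Polynomial.coeff_C_succ]

theorem derivative_mul {R : Type*} [CommRing R] (u v : R⟦X⟧) :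
    PowerSeries.derivative R (u * v) =
      u • PowerSeries.derivative R v + v • PowerSeries.derivative R u :=
  (PowerSeries.derivative R).leibniz u v

/-- The derivative `d/dz` as a `K`-linear derivation of families. -/
def familyDerivative (K : Type*) [CommRing K] : Derivation K K[X]⟦X⟧ K[X]⟦X⟧ :=
  Derivation.mk'
    { toFun := PowerSeries.derivative K[X]
      map_add' := map_add _
      map_smul' := fun r u => by
        ext j : 1
        simp [PowerSeries.coeff_derivative] }
    derivative_mul

theorem isCoherent_iterates {f : K⟦X⟧} (hf : IsUnitary f) (hh : IsDiffAlgebraic (iterLog hf)) :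
    IsCoherent (iterates f) := by
  have := algebraRat.charZero K
  have : CharZero K[X]⟦X⟧ := ⟨fun m n h => by
    simpa using congrArg (fun u => PowerSeries.constantCoeff (spec (0 : K) u)) h⟩
  have : FaithfulSMul K K[X]⟦X⟧ := by
    refine (faithfulSMul_iff_algebraMap_injective _ _).2 fun a b h => ?_
    rw [← AlgHom.commutes constFamily, ← AlgHom.commutes constFamily] at h
    exact PowerSeries.C_injective (constFamily_injective h)
  by_cases h0 : iterLog hf = 0
  -- If `f_* = 0`, Julia's equation is void, but the family is constantly `z` and `Y - z` kills it.
  · refine isCoherent_iterates_of_evalFamily hf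
      (P := MvPolynomial.X 0 - MvPolynomial.C Polynomial.X) ?_ ?_
    · intro h
      have := congrArg (MvPolynomial.eval 0) h
      simp at this
    · rw [iterFlow_of_iterLog_eq_zero hf h0]
      simp [DiffPoly.evalFamily]
  obtain ⟨s, hsfin, hX, hs, halg⟩ := hh.exists_finite
  have hdep := not_algebraicIndependent_of_julia (familyDerivative K) constFamily_injective
    (flow_injective (isUnipotent_compHom hf)) hsfin hs hX halg h0 derivative_constFamily
    (derivative_flow _ h0) (flow_generator_X _)
  rw [algebraicIndependent_iff] at hdep
  push Not at hdep
  obtain ⟨P, hP, hP0⟩ := hdep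
  refine isCoherent_iterates_of_evalFamily hf (P := MvPolynomial.map Polynomial.C P) ?_ ?_
  · exact (map_ne_zero_iff _ (MvPolynomial.map_injective _ Polynomial.C_injective)).2 hP0
  · rw [evalFamily_map_C]
    exact hP

end

end

/-! ### Differentially transcendental `f_*`: total incoherence -/

section

section Jets

variable {K : Type*} [CommRing K]

theorem coeff_taylor_iterate_derivative (a : K) (p : K[X]) (i : ℕ) :
    (Polynomial.derivative^[i] p).eval a = i.factorial * (Polynomial.taylor a p).coeff i := by
  rw [Polynomial.taylor_coeff, ← Polynomial.factorial_smul_hasseDeriv]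
  simp

theorem derivative_iterate_coe (n : ℕ) (p : K[X]) :
    (PowerSeries.derivative K)^[n] (p : K⟦X⟧) = (Polynomial.derivative^[n] p : K[X]) := by
  induction n with
  | zero => rfl
  | succ n ih => rw [Function.iterate_succ_apply', ih, PowerSeries.derivative_coe,
      Function.iterate_succ_apply']

theorem evalAt_coe (P : DiffPoly K) (p : K[X]) :
    P.evalAt (p : K⟦X⟧) =
      (MvPolynomial.eval (fun n => Polynomial.derivative^[n] p) P : K[X]) := by
  rw [← Polynomial.coeToPowerSeries.ringHom_apply, ← Polynomial.coeToPowerSeries.ringHom_apply,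
    MvPolynomial.eval, MvPolynomial.coe_eval₂Hom,
    MvPolynomial.hom_eval₂, DiffPoly.evalAt]
  congr 1
  funext n
  exact derivative_iterate_coe n p

variable [Algebra ℚ K]

/-- A unitary polynomial with prescribed derivatives of order less than `N` at `a`. -/
theorem exists_unitary_polynomial (a : ℚ) (ha : a ≠ 0) (N : ℕ) (c : ℕ → K) :
    ∃ p : K[X], IsUnitary (p : K⟦X⟧) ∧
      ∀ i < N, (Polynomial.derivative^[i] p).eval (algebraMap ℚ K a) = c i := by
  set b := algebraMap ℚ K a
  -- Chinese remainders: `b` is a unit, being a nonzero rational, so congruences modulo `X ^ 2` and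
  -- `(X - b) ^ N` can be imposed together.
  have hcop : IsCoprime ((Polynomial.X : K[X]) ^ 2) ((Polynomial.X - Polynomial.C b) ^ N) := by
    refine IsCoprime.pow ⟨Polynomial.C (algebraMap ℚ K a⁻¹), -Polynomial.C (algebraMap ℚ K a⁻¹), ?_⟩
    have : algebraMap ℚ K a⁻¹ * b = 1 := by rw [← map_mul, inv_mul_cancel₀ ha, map_one]
    rw [mul_sub, neg_mul, neg_mul, ← Polynomial.C_mul, this, Polynomial.C_1]
    ring
  obtain ⟨u, v, huv⟩ := hcop
  set q : K[X] := Polynomial.taylor (-b)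
    (∑ i ∈ Finset.range N, Polynomial.monomial i (algebraMap ℚ K (i.factorial : ℚ)⁻¹ * c i)) with hq
  -- The left form shows unitarity; the right form shows agreement with the Taylor polynomial `q` to
  -- order `N` at `b`.
  have hp : Polynomial.X + Polynomial.X ^ 2 * (u * (q - Polynomial.X)) =
      q - (Polynomial.X - Polynomial.C b) ^ N * (v * (q - Polynomial.X)) := by
    linear_combination (q - Polynomial.X) * huv
  refine ⟨Polynomial.X + Polynomial.X ^ 2 * (u * (q - Polynomial.X)), ⟨?_, ?_⟩, fun i hi => ?_⟩
  · rw [Polynomial.coeff_coe, Polynomial.coeff_add, Polynomial.coeff_X_pow_mul']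
    simp
  · rw [Polynomial.coeff_coe, Polynomial.coeff_add, Polynomial.coeff_X_pow_mul']
    simp
  · rw [hp, coeff_taylor_iterate_derivative, map_sub, Polynomial.taylor_mul, Polynomial.taylor_pow,
      map_sub, Polynomial.taylor_X, Polynomial.taylor_C, add_sub_cancel_right,
      Polynomial.coeff_sub, Polynomial.coeff_X_pow_mul', if_neg (by omega), sub_zero, hq,
      Polynomial.taylor_taylor, add_neg_cancel, Polynomial.taylor_zero, Polynomial.finsetSum_coeff]
    simp only [Polynomial.coeff_monomial]
    rw [Finset.sum_ite_eq' , if_pos (Finset.mem_range.2 hi), ← mul_assoc,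
      ← map_natCast (algebraMap ℚ K), ← map_mul, mul_inv_cancel₀ (by positivity), map_one, one_mul]

variable [IsDomain K]

/-- A differential polynomial that vanishes at all unitary series is zero. -/
theorem eq_zero_of_forall_unitary {P : DiffPoly K}
    (hP : ∀ g : K⟦X⟧, IsUnitary g → P.evalAt g = 0) : P = 0 := by
  have := algebraRat.charZero K
  -- Freeze `z` at a positive integer: jets of unitary polynomials there are arbitrary, so the
  -- frozen polynomial vanishes at every point of an infinite domain.
  have key : ∀ m : ℕ, MvPolynomial.map (Polynomial.evalRingHom ((m + 1 : ℕ) : K)) P = 0 := by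
    intro m
    refine MvPolynomial.funext fun c => ?_
    obtain ⟨N, hN⟩ := P.vars.bddAbove
    obtain ⟨p, hp, hpc⟩ := exists_unitary_polynomial ((m + 1 : ℕ) : ℚ) (by positivity) (N + 1) c
    rw [map_natCast] at hpc
    have h1 := hP _ hp
    rw [evalAt_coe, Polynomial.coe_eq_zero_iff] at h1
    have h2 := congrArg (Polynomial.evalRingHom ((m + 1 : ℕ) : K)) h1
    rw [MvPolynomial.eval, MvPolynomial.coe_eval₂Hom, MvPolynomial.hom_eval₂, map_zero] at h2
    rw [map_zero, MvPolynomial.eval_map, ← h2]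
    refine MvPolynomial.eval₂Hom_congr' (by simp) ?_ rfl
    intro i hi _
    exact (hpc i (Nat.lt_succ_iff.2 (hN hi))).symm
  ext1 d
  refine Polynomial.eq_of_infinite_eval_eq _ _ ?_
  refine (Set.infinite_range_of_injective
    (f := fun m : ℕ => ((m + 1 : ℕ) : K)) fun a b h => by simpa using h).mono ?_
  rintro _ ⟨m, rfl⟩
  have := congrArg (MvPolynomial.coeff d) (key m)
  rw [MvPolynomial.coeff_map] at this
  simpa using this

end Jets

variable {K : Type*} [CommRing K]

theorem exists_evalAt_derivative (Q : DiffPoly K) :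
    ∃ Q' : DiffPoly K, ∀ h, Q'.evalAt h = PowerSeries.derivative K (Q.evalAt h) := by
  induction Q using MvPolynomial.induction_on with
  | C p => exact ⟨MvPolynomial.C (Polynomial.derivative p), fun h => by simp [DiffPoly.evalAt,
      PowerSeries.derivative_coe]⟩
  | add P Q hP hQ =>
    obtain ⟨P', hP⟩ := hP
    obtain ⟨Q', hQ⟩ := hQ
    refine ⟨P' + Q', fun h => ?_⟩
    have h1 := hP h
    have h2 := hQ h
    simp only [DiffPoly.evalAt, MvPolynomial.eval₂_add, map_add] at *
    rw [h1, h2]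
  | mul_X P n hP =>
    obtain ⟨P', hP⟩ := hP
    refine ⟨P' * MvPolynomial.X n + P * MvPolynomial.X (n + 1), fun h => ?_⟩
    have h1 := hP h
    simp only [DiffPoly.evalAt, MvPolynomial.eval₂_add, MvPolynomial.eval₂_mul,
      MvPolynomial.eval₂_X] at *
    rw [derivative_mul, h1, Function.iterate_succ_apply']
    simp only [smul_eq_mul]
    ring

theorem exists_evalAt_iterate_derivative (Q : DiffPoly K) (n : ℕ) :
    ∃ Q' : DiffPoly K, ∀ h, Q'.evalAt h = (PowerSeries.derivative K)^[n] (Q.evalAt h) := by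
  induction n with
  | zero => exact ⟨Q, fun _ => rfl⟩
  | succ n ih =>
    obtain ⟨Q', hQ'⟩ := ih
    obtain ⟨Q'', hQ''⟩ := exists_evalAt_derivative Q'
    exact ⟨Q'', fun h => by rw [hQ'', hQ', Function.iterate_succ_apply']⟩

theorem paramCoeff_iterate_derivative (k n : ℕ) (u : K[X]⟦X⟧) :
    paramCoeff k ((PowerSeries.derivative K[X])^[n] u) =
      (PowerSeries.derivative K)^[n] (paramCoeff k u) := by
  induction n with
  | zero => rfl
  | succ n ih => rw [Function.iterate_succ_apply', paramCoeff_derivative, ih,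
      Function.iterate_succ_apply']

variable [Algebra ℚ K] [IsDomain K]

/-- The order of quantifiers matters: `Q` is built from the recursion for `f^[T]` alone, hence works
for every unitary `f`. -/
theorem exists_evalAt_iterLog (k : ℕ) :
    ∃ Q : DiffPoly K, ∀ (f : K⟦X⟧) (hf : IsUnitary f),
      paramCoeff k (iterFlow hf) = Q.evalAt (iterLog hf) := by
  induction k with
  | zero =>
    exact ⟨MvPolynomial.C Polynomial.X, fun f hf => by
      simp [paramCoeff_zero_iterFlow, DiffPoly.evalAt]⟩
  | succ k ih =>
    obtain ⟨Q, hQ⟩ := ih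
    obtain ⟨Q', hQ'⟩ := exists_evalAt_derivative Q
    refine ⟨MvPolynomial.C (Polynomial.C (algebraMap ℚ K ((k + 1 : ℕ) : ℚ)⁻¹)) *
      (MvPolynomial.X 0 * Q'), fun f hf => ?_⟩
    have h1 := paramCoeff_succ_iterFlow hf k
    rw [hQ, ← hQ'] at h1
    have h2 : DiffPoly.evalAt (MvPolynomial.C (Polynomial.C (algebraMap ℚ K ((k + 1 : ℕ) : ℚ)⁻¹)) *
        (MvPolynomial.X 0 * Q')) (iterLog hf) =
        PowerSeries.C (algebraMap ℚ K ((k + 1 : ℕ) : ℚ)⁻¹) *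
          (iterLog hf * Q'.evalAt (iterLog hf)) := by
      rw [DiffPoly.evalAt, MvPolynomial.eval₂_mul, MvPolynomial.eval₂_mul, MvPolynomial.eval₂_C,
        MvPolynomial.eval₂_X, Polynomial.coeToPowerSeries.ringHom_apply, Polynomial.coe_C]
      rfl
    have h3 : algebraMap ℚ K ((k + 1 : ℕ) : ℚ)⁻¹ * ((k : K) + 1) = 1 := by
      rw [← Nat.cast_succ, ← map_natCast (algebraMap ℚ K), ← map_mul,
        inv_mul_cancel₀ (by positivity), map_one]
    rw [h2, ← h1]
    ext j
    rw [PowerSeries.coeff_C_mul, PowerSeries.coeff_smul, smul_eq_mul, ← mul_assoc, h3, one_mul]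

/-- The coefficients of `P(f^[T])` with respect to `T` are given by universal differential
polynomials in the iterative logarithm of `f`. -/
theorem exists_evalAt_paramCoeff (P : DiffPoly K) (k : ℕ) :
    ∃ Q : DiffPoly K, ∀ (f : K⟦X⟧) (hf : IsUnitary f),
      paramCoeff k (P.evalFamily (iterFlow hf)) = Q.evalAt (iterLog hf) := by
  induction P using MvPolynomial.induction_on generalizing k with
  | C p =>
    refine ⟨if k = 0 then MvPolynomial.C p else 0, fun f hf => ?_⟩
    ext j
    rw [coeff_paramCoeff, DiffPoly.evalFamily, MvPolynomial.eval₂_C]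
    change (PowerSeries.coeff j (constFamily (p : K⟦X⟧))).coeff k = _
    rw [coeff_constFamily, Polynomial.coeff_C]
    split_ifs <;> simp [DiffPoly.evalAt]
  | add P Q hP hQ =>
    obtain ⟨P', hP⟩ := hP k
    obtain ⟨Q', hQ⟩ := hQ k
    refine ⟨P' + Q', fun f hf => ?_⟩
    have h1 := hP f hf
    have h2 := hQ f hf
    simp only [DiffPoly.evalAt, DiffPoly.evalFamily, MvPolynomial.eval₂_add, map_add] at *
    rw [h1, h2]
  | mul_X P n hP =>
    choose P' hP using hP
    choose Y hY using exists_evalAt_iterLog (K := K)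
    choose Y' hY' using fun k => exists_evalAt_iterate_derivative (Y k) n
    refine ⟨∑ p ∈ Finset.HasAntidiagonal.antidiagonal k, P' p.1 * Y' p.2, fun f hf => ?_⟩
    have h1 : DiffPoly.evalFamily (P * MvPolynomial.X n) (iterFlow hf) =
        DiffPoly.evalFamily P (iterFlow hf) * (PowerSeries.derivative K[X])^[n] (iterFlow hf) := by
      simp [DiffPoly.evalFamily]
    rw [h1, paramCoeff_mul]
    simp only [paramCoeff_iterate_derivative, hP, hY, ← hY']
    simp [DiffPoly.evalAt, MvPolynomial.eval₂_sum]

theorem isDiffAlgebraic_iterLog {f : K⟦X⟧} (hf : IsUnitary f) {G : Set K⟦X⟧}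
    (hG : G ⊆ iterates f) (hinf : G.Infinite) (hcoh : IsCoherent G) :
    IsDiffAlgebraic (iterLog hf) := by
  have := algebraRat.charZero K
  obtain ⟨P, hP0, hP⟩ := hcoh
  by_contra hdt
  have h1 : ({n | iterate f n ∈ G} : Set ℕ).Infinite := by
    refine fun hfin => hinf ((hfin.image (iterate f)).subset fun g hg => ?_)
    obtain ⟨n, rfl⟩ := hG hg
    exact ⟨n, hg, rfl⟩
  have h2 : P.evalFamily (iterFlow hf) = 0 := by
    refine spec_ext (h1.image (Nat.cast_injective (R := K)).injOn) ?_
    rintro _ ⟨n, hn, rfl⟩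
    rw [spec_evalFamily, spec_iterFlow, map_zero, hP _ hn]
  choose Q hQ using exists_evalAt_paramCoeff P
  have h3 : ∀ k, Q k = 0 := fun k => by
    by_contra hk
    exact hdt ⟨Q k, hk, by rw [← hQ, h2, map_zero]⟩
  -- Since the `Q k` do not depend on `f`, their vanishing passes to any unitary `g`; then `T = 1`
  -- recovers `g` itself.
  refine hP0 (eq_zero_of_forall_unitary fun g hg => ?_)
  have h4 : P.evalFamily (iterFlow hg) = 0 := paramCoeff_ext fun k => by
    rw [hQ, h3, map_zero, DiffPoly.evalAt, MvPolynomial.eval₂_zero]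
  have h5 := spec_evalFamily ((1 : ℕ) : K) P (iterFlow hg)
  rw [h4, map_zero, spec_iterFlow, iterate_eq_compHom_pow hg, pow_one, compHom_X] at h5
  exact h5.symm

end

end ItLog

end

theorem mainTheorem5 {K : Type*} [CommRing K] [IsDomain K] [Algebra ℚ K]
    (f : K⟦X⟧) (hf : ItLog.IsUnitary f) :
    ∃ fstar : K⟦X⟧,
      ItLog.IsIterativeLogarithm f fstar ∧
      (∀ h : K⟦X⟧, ItLog.IsIterativeLogarithm f h → h = fstar) ∧
      Xor
        (ItLog.IsDiffAlgebraic fstar ∧ ItLog.IsCoherent (ItLog.iterates f))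
        (ItLog.IsDiffTranscendental fstar ∧ ItLog.IsTotallyIncoherent (ItLog.iterates f)) := by
  refine ⟨ItLog.iterLog hf, ItLog.isIterativeLogarithm_iterLog hf,
    fun h hh => hh.unique (ItLog.isIterativeLogarithm_iterLog hf), ?_⟩
  by_cases h : ItLog.IsDiffAlgebraic (ItLog.iterLog hf)
  · exact Or.inl ⟨⟨h, ItLog.isCoherent_iterates hf h⟩, fun h' => h'.1 h⟩
  · exact Or.inr ⟨⟨h, fun G hG hinf hcoh => h (ItLog.isDiffAlgebraic_iterLog hf hG hinf hcoh)⟩,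
      fun h' => h h'.1⟩
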